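/- **Lemma 2.2 (Ecker).** Let $n\ge 3$. There is a constant $C(n)>0$, depending only on $n$, with the following property. Let $(M,g)$ be a (nonempty) closed smooth Riemannian manifold of dimension $n$, with scalar curvature $R(g)$ and volume measure $dV_g$. For $\tau>0$ and a smooth function $f$ on $M$ put $$\mathcal W(g,f,\tau)=(4\pi\tau)^{-n/2}\int_M e^{-f}\bigl[\tau\,(R(g)+|\nabla f|^2)+f-n\bigr]\,dV_g ,$$ and let $$\mu(g,\tau)=\inf\Bigl\{\mathcal W(g,f,\tau)\;:\; f\in C^\infty(M),\ (4\pi\tau)^{-n/2}\int_M e^{-f}\,dV_g=1\Bigr\}.$$ Let $C_S=C_S(g)$ be a Sobolev constant for $g$, that is, a real number such that $$\Bigl(\int_M |w|^{\frac{2n}{n-2}}\,dV_g\Bigr)^{\frac{n-2}{2n}}\le C_S\Bigl[\Bigl(\int_M|\nabla w|^2\,dV_g\Bigr)^{1/2}+\Bigl(\int_M w^2\,dV_g\Bigr)^{1/2}\Bigr]\qquad\text{for all } w\in C^\infty(M).$$ Then for every $\tau>0$ $$\mu(g,\tau)\ \ge\ -C(n)\bigl(1+\ln^+ C_S(g)+\ln^+\tau\bigr)+\tau\,\inf_M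 R(g),$$ where $\ln^+ s=\max(\ln s,0)$. In particular $\mu(g,\tau)\ge -C(n)(1+\ln C_S(g)+\ln\tau)+\tau\inf_M R(g)$ whenever $C_S(g)\ge1$ and $\tau\ge1$. -/

import Mathlib

open MeasureTheory Set
open scoped Manifold ContDiff ENNReal

noncomputable section

namespace Perelman

/-- The model space `ℝⁿ`, with its Euclidean norm and Lebesgue measure. -/
abbrev Model (n : ℕ) : Type := EuclideanSpace ℝ (Fin n)

/-- A smooth Riemannian metric on the `n`-dimensional smooth manifold `M`. -/
abbrev Metric (n : ℕ) (M : Type*) [TopologicalSpace M] [ChartedSpace (Model n) M]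
    [IsManifold 𝓘(ℝ, Model n) ∞ M] : Type _ :=
  Bundle.ContMDiffRiemannianMetric 𝓘(ℝ, Model n) ∞ (Model n)
    (fun x : M ↦ TangentSpace 𝓘(ℝ, Model n) x)

/-! ### Curvature of a metric on an open subset of `ℝⁿ`

A metric is given by `h : ℝⁿ → (ℝⁿ →L ℝⁿ →L ℝ)`. The map `(h y).inverse`, from the dual of `ℝⁿ` to
`ℝⁿ`, raises the index: its matrix is `(hⁱʲ)`. -/

section Coordinates

variable {n : ℕ}

/-- The Christoffel symbols as a vector-valued bilinear map, `Γ(u,v)ᵏ = Γᵏᵢⱼ uⁱ vʲ`, that is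
`h(Γ(u,v), w) = ½ (∂ᵤ h(v,w) + ∂ᵥ h(u,w) - ∂_w h(u,v))` for all `w`. -/
def christoffel (h : Model n → Model n →L[ℝ] Model n →L[ℝ] ℝ) (y u v : Model n) : Model n :=
  (h y).inverse
    ((1 / 2 : ℝ) • (fderiv ℝ h y u v + fderiv ℝ h y v u - ((fderiv ℝ h y).flip u).flip v))

/-- The Riemann curvature `R(u,v)w = ∇ᵤ∇ᵥw - ∇ᵥ∇ᵤw` for constant vector fields `u, v, w`. -/
def riemannCurvature (h : Model n → Model n →L[ℝ] Model n →L[ℝ] ℝ) (y u v w : Model n) :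
    Model n :=
  fderiv ℝ (fun z ↦ christoffel h z v w) y u - fderiv ℝ (fun z ↦ christoffel h z u w) y v
    + christoffel h y u (christoffel h y v w) - christoffel h y v (christoffel h y u w)

/-- The Ricci curvature `Ric(v,w)`, the trace of `u ↦ R(u,v)w`. -/
def ricciCurvature (h : Model n → Model n →L[ℝ] Model n →L[ℝ] ℝ) (y v w : Model n) : ℝ :=
  ∑ i : Fin n, riemannCurvature h y (EuclideanSpace.single i 1) v w i

/-- The scalar curvature `hʲᵏ Ricⱼₖ`, the metric trace of the Ricci curvature. -/
def scalarCurvatureCoord (h : Model n → Model n →L[ℝ] Model n →L[ℝ] ℝ) (y : Model n) : ℝ :=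
  ∑ j : Fin n, ricciCurvature h y ((h y).inverse (EuclideanSpace.proj j))
    (EuclideanSpace.single j 1)

end Coordinates

/-! ### Riemannian geometry of `(M, g)` -/

section Manifold

variable {n : ℕ} {M : Type*} [TopologicalSpace M] [ChartedSpace (Model n) M]
  [IsManifold 𝓘(ℝ, Model n) ∞ M]

/-- The metric `g` read in the chart `e`: the pull-back of `g` under `e⁻¹`
(meaningful on `e.target`). -/
def chartMetric (g : Metric n M) (e : OpenPartialHomeomorph M (Model n)) (y : Model n) :
    Model n →L[ℝ] Model n →L[ℝ] ℝ :=
  let A : Model n →L[ℝ] TangentSpace 𝓘(ℝ, Model n) (e.symm y) :=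
    mfderiv 𝓘(ℝ, Model n) 𝓘(ℝ, Model n) e.symm y
  (ContinuousLinearMap.precomp ℝ A) ∘L (g.inner (e.symm y)) ∘L A

/-- The scalar curvature `R(g)` at `x`, computed in the preferred chart around `x`. -/
def scalarCurvature (g : Metric n M) (x : M) : ℝ :=
  scalarCurvatureCoord (chartMetric g (chartAt (Model n) x)) (chartAt (Model n) x x)

/-- The Riemannian gradient: `g(∇f, v) = df(v)` for all `v` (see `inner_gradient`). -/
def gradient (g : Metric n M) (f : M → ℝ) (x : M) : TangentSpace 𝓘(ℝ, Model n) x :=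
  (g.inner x).inverse (mvfderiv 𝓘(ℝ, Model n) f x)

theorem isInvertible_of_pos {n : ℕ} (h : Model n →L[ℝ] Model n →L[ℝ] ℝ)
    (hpos : ∀ v, v ≠ 0 → 0 < h v v) : h.IsInvertible := by
  have hinj : Function.Injective h := by
    refine (injective_iff_map_eq_zero h).2 fun v hv ↦ ?_
    by_contra hne
    have := hpos v hne
    simp [hv] at this
  have hdim : Module.finrank ℝ (Model n) = Module.finrank ℝ (Model n →L[ℝ] ℝ) :=
    (InnerProductSpace.toDual ℝ (Model n)).toLinearEquiv.finrank_eq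
  have : FiniteDimensional ℝ (Model n →L[ℝ] ℝ) :=
    (InnerProductSpace.toDual ℝ (Model n)).toLinearEquiv.finiteDimensional
  exact ⟨(LinearMap.linearEquivOfInjective (h : Model n →ₗ[ℝ] _) hinj hdim).toContinuousLinearEquiv,
    by ext; rfl⟩

theorem inner_gradient (g : Metric n M) (f : M → ℝ) (x : M) (v : TangentSpace 𝓘(ℝ, Model n) x) :
    g.inner x (gradient g f x) v = mvfderiv 𝓘(ℝ, Model n) f x v := by
  have h : (g.inner x).IsInvertible := isInvertible_of_pos (g.inner x) (g.pos x)
  exact congrArg (fun L ↦ L v) (h.self_apply_inverse (mvfderiv 𝓘(ℝ, Model n) f x))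

/-- `|∇f|²` with respect to `g`. -/
def gradNormSq (g : Metric n M) (f : M → ℝ) (x : M) : ℝ :=
  g.inner x (gradient g f x) (gradient g f x)

/-- The Gram matrix `(gᵢⱼ)` in the chart `e`. -/
def gramMatrix (g : Metric n M) (e : OpenPartialHomeomorph M (Model n)) (y : Model n) :
    Matrix (Fin n) (Fin n) ℝ :=
  Matrix.of fun i j ↦
    chartMetric g e y (EuclideanSpace.single i 1) (EuclideanSpace.single j 1)

variable [MeasurableSpace M]

/-- The Riemannian volume `√(det gᵢⱼ) dy¹ ⋯ dyⁿ` on the domain of the chart `e`, as a measure on `M`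
that vanishes outside `e.source`. -/
def chartVolume (g : Metric n M) (e : OpenPartialHomeomorph M (Model n)) : Measure M :=
  ((volume.restrict e.target).withDensity
    (fun y ↦ ENNReal.ofReal (Real.sqrt (gramMatrix g e y).det))).map e.symm

/-- A smooth partition of unity subordinate to the domains of the preferred charts. -/
def chartPartition (n : ℕ) (M : Type*) [TopologicalSpace M] [ChartedSpace (Model n) M]
    [IsManifold 𝓘(ℝ, Model n) ∞ M] [T2Space M] [SigmaCompactSpace M] :
    SmoothPartitionOfUnity M 𝓘(ℝ, Model n) M univ :=
  (SmoothPartitionOfUnity.exists_isSubordinate_chartAt_source 𝓘(ℝ, Model n) M).choose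

/-- The Riemannian volume measure `dV_g`, patched together from the chart volumes by a partition of
unity: `∫ φ dV_g = ∑ᵢ ∫ ρᵢ φ √(det gᵢⱼ) dy`. -/
def volumeMeasure [T2Space M] [SigmaCompactSpace M] (g : Metric n M) : Measure M :=
  Measure.sum fun i : M ↦ (chartVolume g (chartAt (Model n) i)).withDensity
    (fun x ↦ ENNReal.ofReal (chartPartition n M i x))

variable [T2Space M] [SigmaCompactSpace M]

/-- Perelman's functional
`𝒲(g,f,τ) = (4πτ)^{-n/2} ∫ e^{-f} [τ(R + |∇f|²) + f - n] dV_g`. -/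
def functionalW (g : Metric n M) (f : M → ℝ) (τ : ℝ) : ℝ :=
  (4 * Real.pi * τ) ^ (-(n : ℝ) / 2) *
    ∫ x, Real.exp (-f x) * (τ * (scalarCurvature g x + gradNormSq g f x) + f x - n)
      ∂(volumeMeasure g)

/-- The smooth functions `f` with `(4πτ)^{-n/2} ∫ e^{-f} dV_g = 1`. -/
def admissible (g : Metric n M) (τ : ℝ) : Set (M → ℝ) :=
  {f | ContMDiff 𝓘(ℝ, Model n) 𝓘(ℝ, ℝ) ∞ f ∧
    (4 * Real.pi * τ) ^ (-(n : ℝ) / 2) * ∫ x, Real.exp (-f x) ∂(volumeMeasure g) = 1}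

/-- Perelman's `μ(g,τ) = inf 𝒲(g,·,τ)` over the admissible functions. The infimum is taken in the
extended reals, so that a lower bound for it is a genuine one. -/
def mu (g : Metric n M) (τ : ℝ) : EReal :=
  ⨅ f ∈ admissible g τ, (functionalW g f τ : EReal)

/-- `C` is a Sobolev constant for `g`: every smooth function `w` satisfies
`‖w‖_{2n/(n-2)} ≤ C (‖∇w‖₂ + ‖w‖₂)`. -/
def IsSobolevConstant (g : Metric n M) (C : ℝ) : Prop :=
  ∀ w : M → ℝ, ContMDiff 𝓘(ℝ, Model n) 𝓘(ℝ, ℝ) ∞ w →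
    (∫ x, |w x| ^ (2 * (n : ℝ) / ((n : ℝ) - 2)) ∂(volumeMeasure g)) ^ (((n : ℝ) - 2) / (2 * n)) ≤
      C * (Real.sqrt (∫ x, gradNormSq g w x ∂(volumeMeasure g)) +
        Real.sqrt (∫ x, w x ^ 2 ∂(volumeMeasure g)))

end Manifold

end Perelman

end

set_option maxSynthPendingDepth 3

/-! With `k = (4πτ)^{-n/2}`, put `w = √k e^{-f/2}` and `ρ = w²`. Admissibility says `∫ ρ = 1`, and
since `f = log k - log ρ` and `4|∇w|² = ρ|∇f|²`, `𝒲 = ∫ (τ R ρ + 4τ|∇w|² - ρ log ρ) + log k - n`.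
Here `R` is bounded below by its infimum. The entropy is controlled by Jensen's inequality for the
probability measure `ρ dV`, namely `∫ ρ log ρ ≤ (n-2)/2 · log ∫ ρ^{n/(n-2)}` (`mul_log_le`), and the
Sobolev inequality for `w` bounds the right side by `n log (C_S (1 + G))` with `G = ‖∇w‖₂`. It
remains to see that `4τG²` absorbs `n log (1 + G)` at a cost depending only on `n` and `ln⁺ τ`
(`log_scale_bound`).

The longer part of the work makes these integrals legitimate. `R` is defined at each point in that
point's own preferred chart, so its continuity, and with it integrability and boundedness below,
requires coordinate invariance (`IsIsometryOn.scalarCurvatureCoord_eq`). Finiteness of the volume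
comes from the existence of an admissible function. -/

namespace Perelman

/-! ### Calculus of operator-valued maps -/

/-- The Leibniz rule for `z ↦ T z (a z) (b z)`. -/
theorem hasFDerivAt_bilinear_apply {E F G K : Type*} [NormedAddCommGroup E] [NormedSpace ℝ E]
    [NormedAddCommGroup F] [NormedSpace ℝ F] [NormedAddCommGroup G] [NormedSpace ℝ G]
    [NormedAddCommGroup K] [NormedSpace ℝ K] {T : K → E →L[ℝ] F →L[ℝ] G} {a : K → E} {b : K → F}
    {T' : K →L[ℝ] E →L[ℝ] F →L[ℝ] G} {a' : K →L[ℝ] E} {b' : K →L[ℝ] F} {y : K}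
    (hT : HasFDerivAt T T' y) (ha : HasFDerivAt a a' y) (hb : HasFDerivAt b b' y) :
    ∃ L : K →L[ℝ] G, HasFDerivAt (fun z ↦ T z (a z) (b z)) L y ∧
      ∀ u, L u = T' u (a y) (b y) + T y (a' u) (b y) + T y (a y) (b' u) := by
  refine ⟨_, (hT.clm_apply ha).clm_apply hb, fun u ↦ ?_⟩
  simp
  abel

/-- The derivative of `z ↦ A z v` in the direction `u`. -/
theorem hasFDerivAt_apply_const {F G K : Type*} [NormedAddCommGroup F] [NormedSpace ℝ F]
    [NormedAddCommGroup G] [NormedSpace ℝ G] [NormedAddCommGroup K] [NormedSpace ℝ K]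
    {A : K → F →L[ℝ] G} {A' : K →L[ℝ] F →L[ℝ] G} {y : K} (hA : HasFDerivAt A A' y) (v : F) :
    HasFDerivAt (fun z ↦ A z v) (A'.flip v) y := by
  simpa using hA.clm_apply (hasFDerivAt_const v y)

/-- The alternating sum defining the Christoffel symbols of the first kind, as a linear function
of the derivative of the metric. -/
noncomputable def christoffelSum (E : Type*) [NormedAddCommGroup E] [NormedSpace ℝ E] :
    (E →L[ℝ] E →L[ℝ] E →L[ℝ] ℝ) →L[ℝ] (E →L[ℝ] E →L[ℝ] E →L[ℝ] ℝ) :=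
  (1 / 2 : ℝ) • (ContinuousLinearMap.id ℝ _ +
    (ContinuousLinearMap.flipₗᵢ ℝ E E (E →L[ℝ] ℝ)).toContinuousLinearEquiv.toContinuousLinearMap -
    (ContinuousLinearMap.compL ℝ E (E →L[ℝ] E →L[ℝ] ℝ) (E →L[ℝ] E →L[ℝ] ℝ)
      (ContinuousLinearMap.flipₗᵢ ℝ E E ℝ).toContinuousLinearEquiv.toContinuousLinearMap) ∘L
    (ContinuousLinearMap.flipₗᵢ ℝ E E (E →L[ℝ] ℝ)).toContinuousLinearEquiv.toContinuousLinearMap)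

/-- Raising the last index of a trilinear form. -/
theorem contDiffAt_compL_comp {E F G K : Type*} [NormedAddCommGroup E] [NormedSpace ℝ E]
    [NormedAddCommGroup F] [NormedSpace ℝ F] [NormedAddCommGroup G] [NormedSpace ℝ G]
    [NormedAddCommGroup K] [NormedSpace ℝ K] {S : K → F →L[ℝ] G}
    {T : K → E →L[ℝ] E →L[ℝ] F} {y : K} (hS : ContDiffAt ℝ ∞ S y) (hT : ContDiffAt ℝ ∞ T y) :
    ContDiffAt ℝ ∞ (fun z ↦ (ContinuousLinearMap.compL ℝ E F G (S z)) ∘L T z) y :=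
  (ContDiffAt.comp (g := ContinuousLinearMap.compL ℝ E F G) y
    (ContinuousLinearMap.compL ℝ E F G).contDiff.contDiffAt hS).clm_comp hT

/-! ### Metrics on open subsets of `ℝⁿ` and changes of coordinates -/

/-- `h` is a smooth Riemannian metric on the open set `U ⊆ ℝⁿ`. -/
structure IsMetricOn {n : ℕ} (h : Model n → Model n →L[ℝ] Model n →L[ℝ] ℝ)
    (U : Set (Model n)) : Prop where
  isOpen : IsOpen U
  contDiffOn : ContDiffOn ℝ ∞ h U
  symm : ∀ y ∈ U, ∀ u v, h y u v = h y v u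
  pos : ∀ y ∈ U, ∀ v, v ≠ 0 → 0 < h y v v

/-- `φ` is a smooth change of coordinates on the open set `U`, pulling back `h'` to `h`. -/
structure IsIsometryOn {n : ℕ} (h h' : Model n → Model n →L[ℝ] Model n →L[ℝ] ℝ)
    (φ : Model n → Model n) (U U' : Set (Model n)) : Prop where
  source : IsMetricOn h U
  target : IsMetricOn h' U'
  mapsTo : MapsTo φ U U'
  contDiffOn : ContDiffOn ℝ ∞ φ U
  isInvertible : ∀ y ∈ U, (fderiv ℝ φ y).IsInvertible
  pullback : ∀ y ∈ U, ∀ u v, h y u v = h' (φ y) (fderiv ℝ φ y u) (fderiv ℝ φ y v)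

/-- The Christoffel symbols as a continuous bilinear map. -/
noncomputable def christoffelMap {n : ℕ} (h : Model n → Model n →L[ℝ] Model n →L[ℝ] ℝ)
    (y : Model n) : Model n →L[ℝ] Model n →L[ℝ] Model n :=
  (ContinuousLinearMap.compL ℝ (Model n) (Model n →L[ℝ] ℝ) (Model n) (h y).inverse) ∘L
    christoffelSum (Model n) (fderiv ℝ h y)

section Isometry

variable {n : ℕ} {h h' : Model n → Model n →L[ℝ] Model n →L[ℝ] ℝ} {φ : Model n → Model n}
  {U U' : Set (Model n)} {y : Model n}

theorem christoffelMap_apply (h : Model n → Model n →L[ℝ] Model n →L[ℝ] ℝ) (y u v : Model n) :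
    christoffelMap h y u v = christoffel h y u v := by
  rfl

namespace IsMetricOn

theorem isInvertible (H : IsMetricOn h U) (hy : y ∈ U) : (h y).IsInvertible :=
  isInvertible_of_pos (h y) (H.pos y hy)

theorem contDiffAt (H : IsMetricOn h U) (hy : y ∈ U) : ContDiffAt ℝ ∞ h y :=
  H.contDiffOn.contDiffAt (H.isOpen.mem_nhds hy)

theorem contDiffAt_inverse (H : IsMetricOn h U) (hy : y ∈ U) :
    ContDiffAt ℝ ∞ (fun z ↦ (h z).inverse) y :=
  (H.isInvertible hy).contDiffAt_map_inverse.comp y (H.contDiffAt hy)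

theorem inverse_symm (H : IsMetricOn h U) (hy : y ∈ U) (α β : Model n →L[ℝ] ℝ) :
    α ((h y).inverse β) = β ((h y).inverse α) := by
  have := H.symm y hy ((h y).inverse α) ((h y).inverse β)
  rwa [(H.isInvertible hy).self_apply_inverse, (H.isInvertible hy).self_apply_inverse] at this

theorem contDiffAt_christoffelMap (H : IsMetricOn h U) (hy : y ∈ U) :
    ContDiffAt ℝ ∞ (christoffelMap h) y := by
  have hD : ContDiffAt ℝ ∞ (fderiv ℝ h) y := (H.contDiffAt hy).fderiv_right (by simp)
  exact contDiffAt_compL_comp (H.contDiffAt_inverse hy)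
    ((christoffelSum (Model n)).contDiff.contDiffAt.comp y hD)

/-- The Koszul identity, free of the inverse metric; the transformation law is proved by testing it
against vectors. -/
theorem apply_christoffel (H : IsMetricOn h U) (hy : y ∈ U) (u v w : Model n) :
    2 * h y (christoffel h y u v) w =
      fderiv ℝ h y u v w + fderiv ℝ h y v u w - fderiv ℝ h y w u v := by
  rw [christoffel, (H.isInvertible hy).self_apply_inverse]
  simp

theorem fderiv_christoffel (H : IsMetricOn h U) (hy : y ∈ U) (u v w : Model n) :
    fderiv ℝ (fun z ↦ christoffel h z v w) y u = fderiv ℝ (christoffelMap h) y u v w := by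
  have hd : HasFDerivAt (christoffelMap h) (fderiv ℝ (christoffelMap h) y) y :=
    ((H.contDiffAt_christoffelMap hy).differentiableAt (by simp)).hasFDerivAt
  have := hasFDerivAt_apply_const (hasFDerivAt_apply_const hd v) w
  simp only [christoffelMap_apply] at this
  rw [this.fderiv]
  rfl

theorem riemannCurvature_eq (H : IsMetricOn h U) (hy : y ∈ U) (u v w : Model n) :
    riemannCurvature h y u v w =
      fderiv ℝ (christoffelMap h) y u v w - fderiv ℝ (christoffelMap h) y v u w
      + christoffelMap h y u (christoffelMap h y v w)
      - christoffelMap h y v (christoffelMap h y u w) := by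
  simp only [riemannCurvature, H.fderiv_christoffel hy, christoffelMap_apply]

end IsMetricOn

namespace IsIsometryOn

theorem contDiffAt (H : IsIsometryOn h h' φ U U') (hy : y ∈ U) : ContDiffAt ℝ ∞ φ y :=
  H.contDiffOn.contDiffAt (H.source.isOpen.mem_nhds hy)

theorem hasFDerivAt (H : IsIsometryOn h h' φ U U') (hy : y ∈ U) :
    HasFDerivAt φ (fderiv ℝ φ y) y :=
  ((H.contDiffAt hy).differentiableAt (by simp)).hasFDerivAt

theorem hasFDerivAt_fderiv (H : IsIsometryOn h h' φ U U') (hy : y ∈ U) :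
    HasFDerivAt (fderiv ℝ φ) (fderiv ℝ (fderiv ℝ φ) y) y :=
  (((H.contDiffAt hy).fderiv_right (m := ∞) (by simp)).differentiableAt (by simp)).hasFDerivAt

theorem second_fderiv_symm (H : IsIsometryOn h h' φ U U') (hy : y ∈ U) (u v : Model n) :
    fderiv ℝ (fderiv ℝ φ) y u v = fderiv ℝ (fderiv ℝ φ) y v u :=
  ((H.contDiffAt hy).isSymmSndFDerivAt (by simpa using ENat.LEInfty.out)) u v

/-- The derivative of the pull-back identity. -/
theorem fderiv_pullback (H : IsIsometryOn h h' φ U U') (hy : y ∈ U) (u v w : Model n) :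
    fderiv ℝ h y u v w =
      fderiv ℝ h' (φ y) (fderiv ℝ φ y u) (fderiv ℝ φ y v) (fderiv ℝ φ y w)
      + h' (φ y) (fderiv ℝ (fderiv ℝ φ) y u v) (fderiv ℝ φ y w)
      + h' (φ y) (fderiv ℝ φ y v) (fderiv ℝ (fderiv ℝ φ) y u w) := by
  have hh : HasFDerivAt h (fderiv ℝ h y) y :=
    ((H.source.contDiffAt hy).differentiableAt (by simp)).hasFDerivAt
  have hh' : HasFDerivAt h' (fderiv ℝ h' (φ y)) (φ y) :=
    ((H.target.contDiffAt (H.mapsTo hy)).differentiableAt (by simp)).hasFDerivAt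
  have h1 := hasFDerivAt_apply_const (hasFDerivAt_apply_const hh v) w
  have hA := H.hasFDerivAt_fderiv hy
  obtain ⟨L, h2, hL⟩ := hasFDerivAt_bilinear_apply (hh'.comp y (H.hasFDerivAt hy))
    (hasFDerivAt_apply_const hA v) (hasFDerivAt_apply_const hA w)
  have he : (fun z ↦ h z v w) =ᶠ[nhds y]
      fun z ↦ (h' ∘ φ) z (fderiv ℝ φ z v) (fderiv ℝ φ z w) := by
    filter_upwards [H.source.isOpen.mem_nhds hy] with z hz using H.pullback z hz v w
  have := congrArg (fun L ↦ L u) (h1.unique (h2.congr_of_eventuallyEq he))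
  exact this.trans (hL u)

/-- The transformation law of the Christoffel symbols. -/
theorem christoffel_transform (H : IsIsometryOn h h' φ U U') (hy : y ∈ U) (u v : Model n) :
    fderiv ℝ φ y (christoffel h y u v) =
      christoffel h' (φ y) (fderiv ℝ φ y u) (fderiv ℝ φ y v) + fderiv ℝ (fderiv ℝ φ) y u v := by
  apply ((H.target.isInvertible (H.mapsTo hy)).bijective).injective
  ext w'
  obtain ⟨w, rfl⟩ := (H.isInvertible y hy).bijective.surjective w'
  have e1 := H.source.apply_christoffel hy u v w
  have e2 := H.target.apply_christoffel (H.mapsTo hy) (fderiv ℝ φ y u) (fderiv ℝ φ y v)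
    (fderiv ℝ φ y w)
  -- Of the six terms in `D²φ`, symmetry of `D²φ` and of `h'` cancels four in the alternating sum;
  -- the other two combine to `2 h'(D²φ(u,v), Dφ w)`.
  rw [H.pullback y hy, H.fderiv_pullback hy, H.fderiv_pullback hy, H.fderiv_pullback hy,
    H.second_fderiv_symm hy v u, H.second_fderiv_symm hy w u, H.second_fderiv_symm hy w v,
    H.target.symm _ (H.mapsTo hy) (fderiv ℝ (fderiv ℝ φ) y u w)] at e1
  rw [map_add, add_apply]
  linarith

/-- The Riemann curvature is a tensor. -/
theorem riemannCurvature_transform (H : IsIsometryOn h h' φ U U') (hy : y ∈ U)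
    (u v w : Model n) :
    fderiv ℝ φ y (riemannCurvature h y u v w) =
      riemannCurvature h' (φ y) (fderiv ℝ φ y u) (fderiv ℝ φ y v) (fderiv ℝ φ y w) := by
  have hΓ : HasFDerivAt (christoffelMap h) (fderiv ℝ (christoffelMap h) y) y :=
    ((H.source.contDiffAt_christoffelMap hy).differentiableAt (by simp)).hasFDerivAt
  have hΓ' : HasFDerivAt (christoffelMap h') (fderiv ℝ (christoffelMap h') (φ y)) (φ y) :=
    ((H.target.contDiffAt_christoffelMap (H.mapsTo hy)).differentiableAt (by simp)).hasFDerivAt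
  have hA := H.hasFDerivAt_fderiv hy
  have hc2 : ContDiffAt ℝ ∞ (fderiv ℝ φ) y := (H.contDiffAt hy).fderiv_right (by simp)
  have hB : HasFDerivAt (fderiv ℝ (fderiv ℝ φ)) (fderiv ℝ (fderiv ℝ (fderiv ℝ φ)) y) y :=
    ((hc2.fderiv_right (m := ∞) (by simp)).differentiableAt (by simp)).hasFDerivAt
  -- The transformation law of `Γ`, valid near `y`, differentiated in the direction `u`.
  have key (u v : Model n) :
      fderiv ℝ (fderiv ℝ φ) y u (christoffelMap h y v w)
        + fderiv ℝ φ y (fderiv ℝ (christoffelMap h) y u v w) =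
      fderiv ℝ (christoffelMap h') (φ y) (fderiv ℝ φ y u) (fderiv ℝ φ y v) (fderiv ℝ φ y w)
      + christoffelMap h' (φ y) (fderiv ℝ (fderiv ℝ φ) y u v) (fderiv ℝ φ y w)
      + christoffelMap h' (φ y) (fderiv ℝ φ y v) (fderiv ℝ (fderiv ℝ φ) y u w)
      + fderiv ℝ (fderiv ℝ (fderiv ℝ φ)) y u v w := by
    have h1 := hA.clm_apply (hasFDerivAt_apply_const (hasFDerivAt_apply_const hΓ v) w)
    obtain ⟨L, h2, hL⟩ := hasFDerivAt_bilinear_apply (hΓ'.comp y (H.hasFDerivAt hy))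
      (hasFDerivAt_apply_const hA v) (hasFDerivAt_apply_const hA w)
    have h3 := h2.add (hasFDerivAt_apply_const (hasFDerivAt_apply_const hB v) w)
    have he : (fun z ↦ fderiv ℝ φ z (christoffelMap h z v w)) =ᶠ[nhds y]
        ((fun z ↦ (christoffelMap h' ∘ φ) z (fderiv ℝ φ z v) (fderiv ℝ φ z w)) +
          fun z ↦ fderiv ℝ (fderiv ℝ φ) z v w) := by
      filter_upwards [H.source.isOpen.mem_nhds hy] with z hz
      simpa [christoffelMap_apply] using H.christoffel_transform hz v w
    have := congrArg (fun L ↦ L u) (h1.unique (h3.congr_of_eventuallyEq he))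
    rw [add_comm]
    exact this.trans (congrArg (· + _) (hL u))
  have hs : fderiv ℝ (fderiv ℝ (fderiv ℝ φ)) y u v = fderiv ℝ (fderiv ℝ (fderiv ℝ φ)) y v u :=
    (hc2.isSymmSndFDerivAt (by simpa using ENat.LEInfty.out)) u v
  have tr (u v : Model n) : fderiv ℝ φ y (christoffelMap h y u v) =
      christoffelMap h' (φ y) (fderiv ℝ φ y u) (fderiv ℝ φ y v)
        + fderiv ℝ (fderiv ℝ φ) y u v := by
    simpa [christoffelMap_apply] using H.christoffel_transform hy u v
  -- Antisymmetrizing in `u, v` removes `D³φ` and `Γ'(D²φ(u,v), ·)` by symmetry; the remaining terms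
  -- in `D²φ` cancel against those produced by the quadratic terms `ΓΓ`.
  have k1 := eq_sub_of_add_eq' (key u v)
  have k2 := eq_sub_of_add_eq' (key v u)
  rw [H.source.riemannCurvature_eq hy, H.target.riemannCurvature_eq (H.mapsTo hy)]
  simp only [map_add, map_sub, k1, k2, tr, hs, H.second_fderiv_symm hy v u]
  abel

end IsIsometryOn

end Isometry

/-! ### The scalar curvature as a trace -/

theorem trace_eq_sum {n : ℕ} (T : Model n →ₗ[ℝ] Model n) :
    LinearMap.trace ℝ (Model n) T = ∑ i : Fin n, T (EuclideanSpace.single i 1) i := by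
  rw [LinearMap.trace_eq_matrix_trace ℝ (EuclideanSpace.basisFun (Fin n) ℝ).toBasis]
  simp [Matrix.trace, LinearMap.toMatrix_apply]

/-- Intertwined endomorphisms have the same trace. -/
theorem trace_eq_of_intertwined {n : ℕ} {A : Model n →L[ℝ] Model n} (hA : A.IsInvertible)
    {S T : Model n →ₗ[ℝ] Model n} (h : ∀ v, A (S v) = T (A v)) :
    LinearMap.trace ℝ (Model n) S = LinearMap.trace ℝ (Model n) T := by
  obtain ⟨e, rfl⟩ := hA
  rw [← LinearMap.trace_conj' S e.toLinearEquiv]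
  congr 1
  ext1 v
  have := h (e.symm v)
  simpa [LinearEquiv.conj_apply] using this

/-- The curvature endomorphism `u ↦ R(u,v)w`. -/
noncomputable def curvatureEnd {n : ℕ} (h : Model n → Model n →L[ℝ] Model n →L[ℝ] ℝ)
    (y v w : Model n) : Model n →ₗ[ℝ] Model n where
  toFun u := fderiv ℝ (christoffelMap h) y u v w - fderiv ℝ (christoffelMap h) y v u w
      + christoffelMap h y u (christoffelMap h y v w)
      - christoffelMap h y v (christoffelMap h y u w)
  map_add' a b := by
    simp only [map_add, add_apply]
    abel
  map_smul' c a := by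
    simp only [map_smul, smul_apply, smul_sub, smul_add, RingHom.id_apply]

/-- The Ricci curvature as a bilinear form. -/
noncomputable def ricciForm {n : ℕ} (h : Model n → Model n →L[ℝ] Model n →L[ℝ] ℝ)
    (y : Model n) : Model n →ₗ[ℝ] Model n →ₗ[ℝ] ℝ :=
  LinearMap.mk₂ ℝ (fun v w ↦ LinearMap.trace ℝ (Model n) (curvatureEnd h y v w))
    (fun v v' w ↦ by
      rw [← map_add]
      congr 1
      ext1 u
      simp only [curvatureEnd, LinearMap.coe_mk, AddHom.coe_mk, LinearMap.add_apply,
        map_add, add_apply]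
      abel)
    (fun c v w ↦ by
      rw [← map_smul]
      congr 1
      ext1 u
      simp only [curvatureEnd, LinearMap.coe_mk, AddHom.coe_mk, LinearMap.smul_apply,
        map_smul, smul_apply, smul_sub, smul_add])
    (fun v w w' ↦ by
      rw [← map_add]
      congr 1
      ext1 u
      simp only [curvatureEnd, LinearMap.coe_mk, AddHom.coe_mk, LinearMap.add_apply,
        map_add]
      abel)
    (fun c v w ↦ by
      rw [← map_smul]
      congr 1
      ext1 u
      simp only [curvatureEnd, LinearMap.coe_mk, AddHom.coe_mk, LinearMap.smul_apply,
        map_smul, smul_sub, smul_add])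

/-- The Ricci endomorphism: `h(P w, v) = Ric(v, w)`. -/
noncomputable def ricciEnd {n : ℕ} (h : Model n → Model n →L[ℝ] Model n →L[ℝ] ℝ)
    (y : Model n) : Model n →ₗ[ℝ] Model n :=
  (h y).inverse.toLinearMap ∘ₗ LinearMap.toContinuousLinearMap.toLinearMap ∘ₗ
    (ricciForm h y).flip

theorem ricciEnd_apply {n : ℕ} (h : Model n → Model n →L[ℝ] Model n →L[ℝ] ℝ) (y w : Model n) :
    ricciEnd h y w = (h y).inverse (LinearMap.toContinuousLinearMap ((ricciForm h y).flip w)) :=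
  rfl

section Trace

variable {n : ℕ} {h h' : Model n → Model n →L[ℝ] Model n →L[ℝ] ℝ} {φ : Model n → Model n}
  {U U' : Set (Model n)} {y : Model n}

namespace IsMetricOn

theorem curvatureEnd_apply (H : IsMetricOn h U) (hy : y ∈ U) (u v w : Model n) :
    curvatureEnd h y v w u = riemannCurvature h y u v w :=
  (H.riemannCurvature_eq hy u v w).symm

theorem ricciForm_apply (H : IsMetricOn h U) (hy : y ∈ U) (v w : Model n) :
    ricciForm h y v w = ricciCurvature h y v w := by
  simp only [ricciForm, LinearMap.mk₂_apply, trace_eq_sum, H.curvatureEnd_apply hy,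
    ricciCurvature]

theorem apply_ricciEnd (H : IsMetricOn h U) (hy : y ∈ U) (v w : Model n) :
    h y (ricciEnd h y w) v = ricciForm h y v w := by
  rw [ricciEnd_apply, (H.isInvertible hy).self_apply_inverse]
  rfl

/-- The trace of an endomorphism is invariant under conjugation, so in this form invariance of the
scalar curvature reduces to that of the Ricci form. -/
theorem scalarCurvatureCoord_eq_trace (H : IsMetricOn h U) (hy : y ∈ U) :
    scalarCurvatureCoord h y = LinearMap.trace ℝ (Model n) (ricciEnd h y) := by
  rw [trace_eq_sum, scalarCurvatureCoord]
  refine Finset.sum_congr rfl fun j _ ↦ ?_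
  rw [ricciEnd_apply, ← H.ricciForm_apply hy]
  exact H.inverse_symm hy (LinearMap.toContinuousLinearMap
    ((ricciForm h y).flip (EuclideanSpace.single j 1))) (EuclideanSpace.proj j)

theorem continuousOn_scalarCurvatureCoord (H : IsMetricOn h U) :
    ContinuousOn (scalarCurvatureCoord h) U := by
  intro y hy
  have hΓ : ContinuousAt (christoffelMap h) y := (H.contDiffAt_christoffelMap hy).continuousAt
  have hD : ContinuousAt (fderiv ℝ (christoffelMap h)) y :=
    ((H.contDiffAt_christoffelMap hy).fderiv_right (m := ∞) (by simp)).continuousAt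
  have hi : ContinuousAt (fun z ↦ (h z).inverse) y := (H.contDiffAt_inverse hy).continuousAt
  -- Near `y` the scalar curvature is a polynomial expression in `h⁻¹`, `Γ` and `DΓ`, all continuous
  -- there.
  have hc : ContinuousAt (fun z ↦ ∑ j : Fin n, ∑ i : Fin n,
      (EuclideanSpace.proj i : Model n →L[ℝ] ℝ) (curvatureEnd h z ((h z).inverse (EuclideanSpace.proj j)) (EuclideanSpace.single j 1)
        (EuclideanSpace.single i 1))) y := by
    refine tendsto_finsetSum _ fun j _ ↦ tendsto_finsetSum _ fun i _ ↦ ?_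
    refine (EuclideanSpace.proj i : Model n →L[ℝ] ℝ).continuous.continuousAt.comp ?_
    have hv : ContinuousAt (fun z ↦ (h z).inverse (EuclideanSpace.proj j)) y :=
      hi.clm_apply continuousAt_const
    exact ((((hD.clm_apply continuousAt_const).clm_apply hv).clm_apply continuousAt_const).sub
      (((hD.clm_apply hv).clm_apply continuousAt_const).clm_apply continuousAt_const)).add
      ((hΓ.clm_apply continuousAt_const).clm_apply
        ((hΓ.clm_apply hv).clm_apply continuousAt_const)) |>.sub
      ((hΓ.clm_apply hv).clm_apply
        ((hΓ.clm_apply continuousAt_const).clm_apply continuousAt_const))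
  refine (hc.congr ?_).continuousWithinAt
  filter_upwards [H.isOpen.mem_nhds hy] with z hz
  simp only [scalarCurvatureCoord, ricciCurvature, H.curvatureEnd_apply hz]
  rfl

end IsMetricOn

namespace IsIsometryOn

theorem ricciForm_transform (H : IsIsometryOn h h' φ U U') (hy : y ∈ U) (v w : Model n) :
    ricciForm h' (φ y) (fderiv ℝ φ y v) (fderiv ℝ φ y w) = ricciForm h y v w := by
  simp only [ricciForm, LinearMap.mk₂_apply]
  refine (trace_eq_of_intertwined (H.isInvertible y hy) fun u ↦ ?_).symm
  rw [H.source.curvatureEnd_apply hy, H.target.curvatureEnd_apply (H.mapsTo hy),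
    H.riemannCurvature_transform hy]

/-- The scalar curvature does not depend on the coordinates. -/
theorem scalarCurvatureCoord_eq (H : IsIsometryOn h h' φ U U') (hy : y ∈ U) :
    scalarCurvatureCoord h y = scalarCurvatureCoord h' (φ y) := by
  rw [H.source.scalarCurvatureCoord_eq_trace hy,
    H.target.scalarCurvatureCoord_eq_trace (H.mapsTo hy)]
  refine trace_eq_of_intertwined (H.isInvertible y hy) fun w ↦ ?_
  apply ((H.target.isInvertible (H.mapsTo hy)).bijective).injective
  ext v'
  obtain ⟨v, rfl⟩ := (H.isInvertible y hy).bijective.surjective v'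
  rw [← H.pullback y hy, H.source.apply_ricciEnd hy, H.target.apply_ricciEnd (H.mapsTo hy),
    H.ricciForm_transform hy]

end IsIsometryOn

end Trace

theorem contMDiffAt_constField {E : Type*} [NormedAddCommGroup E] [NormedSpace ℝ E] (u y : E) :
    ContMDiffAt 𝓘(ℝ, E) 𝓘(ℝ, E).tangent ∞ (fun z : E ↦ (⟨z, u⟩ : TangentBundle 𝓘(ℝ, E) E)) y :=
  contMDiffAt_vectorSpace_iff_contDiffAt.2 contDiffAt_const

section ChartMetric

variable {n : ℕ} {M : Type*} [TopologicalSpace M] [ChartedSpace (Model n) M]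
  [IsManifold 𝓘(ℝ, Model n) ∞ M]

/-! ### The metric in a chart -/

theorem isManifold_one : IsManifold 𝓘(ℝ, Model n) 1 M :=
  IsManifold.of_le (n := ∞) (by simp)

theorem chartMetric_apply (g : Metric n M) (e : OpenPartialHomeomorph M (Model n))
    (y u v : Model n) :
    chartMetric g e y u v =
      g.inner (e.symm y) (mfderiv 𝓘(ℝ, Model n) 𝓘(ℝ, Model n) e.symm y u)
        (mfderiv 𝓘(ℝ, Model n) 𝓘(ℝ, Model n) e.symm y v) := rfl

/-- Smoothness of the coordinate vector fields along `e.symm`; pairing them with the smooth section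
`g` gives smooth metric coefficients. -/
theorem contMDiffAt_chartField {e : OpenPartialHomeomorph M (Model n)}
    (he : e ∈ atlas (Model n) M) {y : Model n} (hy : y ∈ e.target) (u : Model n) :
    ContMDiffAt 𝓘(ℝ, Model n) 𝓘(ℝ, Model n).tangent ∞
      (fun z ↦ (⟨e.symm z, mfderiv 𝓘(ℝ, Model n) 𝓘(ℝ, Model n) e.symm z u⟩ :
        TangentBundle 𝓘(ℝ, Model n) M)) y := by
  have := isManifold_one (n := n) (M := M)
  have hs : ContMDiffAt 𝓘(ℝ, Model n) 𝓘(ℝ, Model n) ∞ e.symm y :=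
    contMDiffAt_symm_of_mem_maximalAtlas (IsManifold.subset_maximalAtlas he) hy
  have hφ := hs.mfderiv_const (m := ∞) (by simp)
  exact ContMDiffAt.clm_apply_of_inCoordinates (b₁ := id) (b₂ := e.symm) (v := fun _ ↦ u)
    (ϕ := fun z ↦ mfderiv 𝓘(ℝ, Model n) 𝓘(ℝ, Model n) e.symm z) hφ
    (contMDiffAt_constField u y) hs

theorem contDiffAt_inner_chartField (g : Metric n M) {e : OpenPartialHomeomorph M (Model n)}
    (he : e ∈ atlas (Model n) M) {y : Model n} (hy : y ∈ e.target) (u v : Model n) :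
    ContDiffAt ℝ ∞ (fun z ↦ chartMetric g e z u v) y := by
  have hs : ContMDiffAt 𝓘(ℝ, Model n) 𝓘(ℝ, Model n) ∞ e.symm y :=
    contMDiffAt_symm_of_mem_maximalAtlas (IsManifold.subset_maximalAtlas he) hy
  have : ContMDiffAt 𝓘(ℝ, Model n) (𝓘(ℝ, Model n).prod 𝓘(ℝ)) ∞
      (fun z ↦ Bundle.TotalSpace.mk' ℝ (E := Bundle.Trivial M ℝ) (e.symm z)
        (chartMetric g e z u v)) y := by
    refine ContMDiffAt.clm_bundle_apply₂ (F₁ := Model n) (F₂ := Model n)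
      (g.contMDiff.contMDiffAt.comp y hs) (contMDiffAt_chartField he hy u)
      (contMDiffAt_chartField he hy v)
  rw [Bundle.contMDiffAt_totalSpace] at this
  exact this.2.contDiffAt

theorem isMetricOn_chartMetric (g : Metric n M) {e : OpenPartialHomeomorph M (Model n)}
    (he : e ∈ atlas (Model n) M) : IsMetricOn (chartMetric g e) e.target where
  isOpen := e.open_target
  contDiffOn := by
    refine contDiffOn_clm_apply.2 fun u ↦ contDiffOn_clm_apply.2 fun v y hy ↦ ?_
    exact (contDiffAt_inner_chartField g he hy u v).contDiffWithinAt
  symm y _ u v := g.symm _ _ _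
  pos y hy v hv := by
    have := isManifold_one (n := n) (M := M)
    refine g.pos _ _ fun h0 ↦ hv ?_
    exact (mdifferentiable_of_mem_atlas he).symm.mfderiv_injective hy (h0.trans (map_zero _).symm)

end ChartMetric

/-! ### Transition maps and chart independence -/

theorem isInvertible_of_injective {n : ℕ} {A : Model n →L[ℝ] Model n}
    (hA : Function.Injective A) : A.IsInvertible :=
  ⟨(LinearEquiv.ofInjectiveEndo (A : Model n →ₗ[ℝ] Model n) hA).toContinuousLinearEquiv,
    by ext; rfl⟩

section Transition

variable {n : ℕ} {M : Type*} [TopologicalSpace M] [ChartedSpace (Model n) M]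
  [IsManifold 𝓘(ℝ, Model n) ∞ M]

theorem fderiv_transition {e e' : OpenPartialHomeomorph M (Model n)}
    (he : e ∈ atlas (Model n) M) (he' : e' ∈ atlas (Model n) M) {y : Model n}
    (hy : y ∈ e.target) (hy' : e.symm y ∈ e'.source) (u : Model n) :
    fderiv ℝ (e' ∘ e.symm) y u =
      mfderiv 𝓘(ℝ, Model n) 𝓘(ℝ, Model n) e' (e.symm y)
        (mfderiv 𝓘(ℝ, Model n) 𝓘(ℝ, Model n) e.symm y u) := by
  have := isManifold_one (n := n) (M := M)
  rw [← mfderiv_eq_fderiv, mfderiv_comp y (mdifferentiableAt_atlas he' hy')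
    (mdifferentiableAt_atlas_symm he hy)]
  rfl

/-- Transition maps between charts are isometries of the metrics in the charts. -/
theorem isIsometryOn_transition (g : Metric n M) {e e' : OpenPartialHomeomorph M (Model n)}
    (he : e ∈ atlas (Model n) M) (he' : e' ∈ atlas (Model n) M) :
    IsIsometryOn (chartMetric g e) (chartMetric g e') (e' ∘ e.symm)
      (e.target ∩ e.symm ⁻¹' e'.source) e'.target := by
  have := isManifold_one (n := n) (M := M)
  have md := mdifferentiable_of_mem_atlas (I := 𝓘(ℝ, Model n)) he
  have md' := mdifferentiable_of_mem_atlas (I := 𝓘(ℝ, Model n)) he'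
  have H := isMetricOn_chartMetric g he
  refine ⟨⟨e.symm.isOpen_inter_preimage e'.open_source, H.contDiffOn.mono inter_subset_left,
      fun y hy ↦ H.symm y hy.1, fun y hy ↦ H.pos y hy.1⟩, isMetricOn_chartMetric g he',
    fun y hy ↦ e'.map_source hy.2, ?_, ?_, ?_⟩
  · intro y hy
    have h1 : ContMDiffAt 𝓘(ℝ, Model n) 𝓘(ℝ, Model n) ∞ e.symm y :=
      contMDiffAt_symm_of_mem_maximalAtlas (IsManifold.subset_maximalAtlas he) hy.1
    have h2 : ContMDiffAt 𝓘(ℝ, Model n) 𝓘(ℝ, Model n) ∞ e' (e.symm y) :=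
      contMDiffAt_of_mem_maximalAtlas (IsManifold.subset_maximalAtlas he') hy.2
    exact (h2.comp y h1).contDiffAt.contDiffWithinAt
  · rintro y ⟨hy, hy'⟩
    refine isInvertible_of_injective fun u v huv ↦ ?_
    rw [fderiv_transition he he' hy hy', fderiv_transition he he' hy hy'] at huv
    exact md.symm.mfderiv_injective hy (md'.mfderiv_injective hy' huv)
  · rintro y ⟨hy, hy'⟩ u v
    have key (u : Model n) : (mfderiv 𝓘(ℝ, Model n) 𝓘(ℝ, Model n) e'.symm (e' (e.symm y))
        (fderiv ℝ (e' ∘ e.symm) y u) : Model n) =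
          mfderiv 𝓘(ℝ, Model n) 𝓘(ℝ, Model n) e.symm y u := by
      rw [fderiv_transition he he' hy hy']
      exact congrArg (fun L ↦ L (mfderiv 𝓘(ℝ, Model n) 𝓘(ℝ, Model n) e.symm y u))
        (md'.symm_comp_deriv hy')
    -- The points `e'.symm (e' (e.symm y))` and `e.symm y` are only propositionally equal. Viewing
    -- every tangent space as `Model n` allows the base point to be rewritten.
    have hb (x x' : M) (hx : x = x') (a b : Model n) :
        (g.inner x : Model n →L[ℝ] Model n →L[ℝ] ℝ) a b =
          (g.inner x' : Model n →L[ℝ] Model n →L[ℝ] ℝ) a b := by rw [hx]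
    have := hb _ _ (e'.left_inv hy') (mfderiv 𝓘(ℝ, Model n) 𝓘(ℝ, Model n) e.symm y u)
      (mfderiv 𝓘(ℝ, Model n) 𝓘(ℝ, Model n) e.symm y v)
    rw [← key u, ← key v] at this
    rw [chartMetric_apply, chartMetric_apply]
    rw [← key u, ← key v]
    exact this.symm

/-- The scalar curvature may be computed in any chart of the atlas. -/
theorem scalarCurvature_eq (g : Metric n M) {e : OpenPartialHomeomorph M (Model n)}
    (he : e ∈ atlas (Model n) M) {x : M} (hx : x ∈ e.source) :
    scalarCurvature g x = scalarCurvatureCoord (chartMetric g e) (e x) := by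
  have hx' := mem_chart_source (Model n) x
  have h := (isIsometryOn_transition g (chart_mem_atlas (Model n) x) he).scalarCurvatureCoord_eq
    (y := chartAt (Model n) x x)
    ⟨(chartAt (Model n) x).map_source hx', by
      simpa [(chartAt (Model n) x).left_inv hx'] using hx⟩
  rw [scalarCurvature, h, Function.comp_apply, (chartAt (Model n) x).left_inv hx']

/-- The chart in the definition jumps with the point; by chart independence the chart at `x` serves
on a whole neighbourhood of `x`. -/
theorem continuous_scalarCurvature (g : Metric n M) : Continuous (scalarCurvature g) := by
  refine continuous_iff_continuousAt.2 fun x ↦ ?_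
  have he := chart_mem_atlas (Model n) x
  have hx := mem_chart_source (Model n) x
  have hc : ContinuousAt
      (scalarCurvatureCoord (chartMetric g (chartAt (Model n) x)) ∘ chartAt (Model n) x) x :=
    ((isMetricOn_chartMetric g he).continuousOn_scalarCurvatureCoord.continuousAt
      ((chartAt (Model n) x).open_target.mem_nhds ((chartAt (Model n) x).map_source hx))).comp
      ((chartAt (Model n) x).continuousAt hx)
  refine hc.congr ?_
  filter_upwards [(chartAt (Model n) x).open_source.mem_nhds hx] with z hz
  exact (scalarCurvature_eq g he hz).symm

/-! ### The norm of the gradient -/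

theorem gradNormSq_eq_mvfderiv (g : Metric n M) (f : M → ℝ) (x : M) :
    gradNormSq g f x = mvfderiv 𝓘(ℝ, Model n) f x
      ((g.inner x).inverse (mvfderiv 𝓘(ℝ, Model n) f x)) :=
  inner_gradient g f x _

/-- `|∇f|²` in the chart `e`. -/
theorem gradNormSq_symm_eq (g : Metric n M) {e : OpenPartialHomeomorph M (Model n)}
    (he : e ∈ atlas (Model n) M) {f : M → ℝ} (hf : ContMDiff 𝓘(ℝ, Model n) 𝓘(ℝ, ℝ) ∞ f)
    {y : Model n} (hy : y ∈ e.target) :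
    gradNormSq g f (e.symm y) = fderiv ℝ (f ∘ e.symm) y
      ((chartMetric g e y).inverse (fderiv ℝ (f ∘ e.symm) y)) := by
  have := isManifold_one (n := n) (M := M)
  have md := mdifferentiable_of_mem_atlas (I := 𝓘(ℝ, Model n)) he
  have hd (u : Model n) : fderiv ℝ (f ∘ e.symm) y u = mvfderiv 𝓘(ℝ, Model n) f (e.symm y)
      (mfderiv 𝓘(ℝ, Model n) 𝓘(ℝ, Model n) e.symm y u) := by
    rw [← mfderiv_eq_fderiv, mfderiv_comp y ((hf _).mdifferentiableAt (by simp))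
      (mdifferentiableAt_atlas_symm he hy)]
    rfl
  obtain ⟨v, hv⟩ : ∃ v : Model n, mfderiv 𝓘(ℝ, Model n) 𝓘(ℝ, Model n) e.symm y v =
      gradient g f (e.symm y) := md.symm.mfderiv_surjective hy _
  have hinv := (isMetricOn_chartMetric g he).isInvertible hy
  have hgrad : (chartMetric g e y).inverse (fderiv ℝ (f ∘ e.symm) y) = v := by
    rw [hinv.inverse_apply_eq]
    ext u
    rw [hd, chartMetric_apply]
    refine (inner_gradient g f (e.symm y) _).symm.trans ?_
    rw [← hv]
  rw [hgrad, hd, gradNormSq, inner_gradient]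
  exact congrArg _ hv.symm

theorem continuous_gradNormSq (g : Metric n M) {f : M → ℝ}
    (hf : ContMDiff 𝓘(ℝ, Model n) 𝓘(ℝ, ℝ) ∞ f) : Continuous (gradNormSq g f) := by
  refine continuous_iff_continuousAt.2 fun x ↦ ?_
  have he := chart_mem_atlas (Model n) x
  have hx := mem_chart_source (Model n) x
  set e := chartAt (Model n) x
  have hy : e x ∈ e.target := e.map_source hx
  have hs : ContMDiffAt 𝓘(ℝ, Model n) 𝓘(ℝ, Model n) ∞ e.symm (e x) :=
    contMDiffAt_symm_of_mem_maximalAtlas (IsManifold.subset_maximalAtlas he) hy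
  have hfe : ContDiffAt ℝ ∞ (f ∘ e.symm) (e x) := (hf.contMDiffAt.comp _ hs).contDiffAt
  have hD : ContinuousAt (fderiv ℝ (f ∘ e.symm)) (e x) :=
    (hfe.fderiv_right (m := ∞) (by simp)).continuousAt
  have hc := (hD.clm_apply (((isMetricOn_chartMetric g he).contDiffAt_inverse
    hy).continuousAt.clm_apply hD)).comp (e.continuousAt hx)
  refine hc.congr ?_
  filter_upwards [e.open_source.mem_nhds hx] with z hz
  have := gradNormSq_symm_eq g he hf (e.map_source hz)
  rw [e.left_inv hz] at this
  exact this.symm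

theorem gradNormSq_nonneg (g : Metric n M) (f : M → ℝ) (x : M) : 0 ≤ gradNormSq g f x := by
  by_cases h : gradient g f x = 0
  · rw [gradNormSq, h]
    simp
  · exact (g.pos x _ h).le

/-- The chain rule `|∇(a ∘ f)|² = (a' ∘ f)² |∇f|²`. -/
theorem gradNormSq_comp (g : Metric n M) {f : M → ℝ} {x : M} {a : ℝ → ℝ} {a' : ℝ}
    (ha : HasDerivAt a a' (f x)) (hf : MDifferentiableAt 𝓘(ℝ, Model n) 𝓘(ℝ, ℝ) f x) :
    gradNormSq g (a ∘ f) x = a' ^ 2 * gradNormSq g f x := by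
  have h : mvfderiv 𝓘(ℝ, Model n) (a ∘ f) x = a' • mvfderiv 𝓘(ℝ, Model n) f x := by
    ext v
    have h1 : mfderiv 𝓘(ℝ, Model n) 𝓘(ℝ, ℝ) (a ∘ f) x =
        (mfderiv 𝓘(ℝ, ℝ) 𝓘(ℝ, ℝ) a (f x)).comp (mfderiv 𝓘(ℝ, Model n) 𝓘(ℝ, ℝ) f x) :=
      mfderiv_comp x ha.differentiableAt.mdifferentiableAt hf
    have h2 : mvfderiv 𝓘(ℝ, Model n) (a ∘ f) x v =
        fderiv ℝ a (f x) (mvfderiv 𝓘(ℝ, Model n) f x v) := by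
      rw [← mfderiv_eq_fderiv]
      exact congrArg (fun L ↦ L v) h1
    rw [h2, ha.hasFDerivAt.fderiv]
    simp [mul_comm]
  rw [gradNormSq_eq_mvfderiv, gradNormSq_eq_mvfderiv, h, map_smul]
  simp
  ring

end Transition

/-! ### The logarithmic Sobolev inequality -/

/-- By scaling, `√τ (1 + G) ≤ (1 + √τ)(1 + √τ G)`, so the `log τ` and `log (1 + G)` terms together
cost at most `n (1 + ln⁺ τ) + n √τ G`, and `4τG²` absorbs the last term up to `n²/16`. The `10n` is
`8n` from `log (4π) ≤ 16`, `n` from `log (1 + √τ)`, and the explicit `n`. -/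
theorem log_scale_bound {n G S τ : ℝ} (hn : 0 ≤ n) (hG : 0 ≤ G) (hτ : 0 < τ) :
    -(10 * n + n ^ 2) * (1 + Real.posLog S + Real.posLog τ) ≤
      4 * τ * G ^ 2 - n / 2 * Real.log (4 * Real.pi * τ) - n * Real.log S
        - n * Real.log (1 + G) - n := by
  have hs : 0 < √τ := Real.sqrt_pos.2 hτ
  have hsq : √τ ^ 2 = τ := Real.sq_sqrt hτ.le
  have h1 : Real.log (4 * Real.pi * τ) = Real.log (4 * Real.pi) + Real.log τ :=
    Real.log_mul (by positivity) hτ.ne'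
  have h2 : Real.log (4 * Real.pi) ≤ 16 :=
    (Real.log_le_self (by positivity)).trans (by linarith [Real.pi_le_four])
  have h3 : Real.log τ = 2 * Real.log √τ := by rw [Real.log_sqrt hτ.le]; ring
  have h4 : Real.log √τ + Real.log (1 + G) ≤ Real.log (1 + √τ) + √τ * G := by
    have hX : 0 ≤ √τ * G := by positivity
    calc Real.log √τ + Real.log (1 + G) = Real.log (√τ * (1 + G)) :=
          (Real.log_mul hs.ne' (by positivity)).symm
      _ ≤ Real.log ((1 + √τ) * (1 + √τ * G)) := by
          apply Real.log_le_log (by positivity)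
          nlinarith [mul_nonneg hs.le hX]
      _ = Real.log (1 + √τ) + Real.log (1 + √τ * G) :=
          Real.log_mul (by positivity) (by positivity)
      _ ≤ _ := by linarith [Real.log_le_sub_one_of_pos (show 0 < 1 + √τ * G by positivity)]
  have h5 : Real.log (1 + √τ) ≤ 1 + Real.posLog τ := by
    have hl2 : Real.log 2 ≤ 1 := by linarith [Real.log_le_sub_one_of_pos (show (0 : ℝ) < 2 by simp)]
    rcases le_total τ 1 with h | h
    · have : √τ ≤ 1 := Real.sqrt_le_one.2 h
      have := Real.log_le_log (by positivity) (show 1 + √τ ≤ 2 by linarith)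
      linarith [Real.posLog_nonneg (x := τ)]
    · have h' : 1 ≤ √τ := Real.one_le_sqrt.2 h
      have := Real.log_le_log (by positivity) (show 1 + √τ ≤ 2 * τ by nlinarith)
      rw [Real.log_mul (by simp) hτ.ne'] at this
      have : Real.log τ ≤ Real.posLog τ := le_max_right _ _
      linarith
  have h6 : Real.log S ≤ Real.posLog S := le_max_right _ _
  -- Expand `(2√τ G - n/4)² ≥ 0`.
  have h7 : n * (√τ * G) ≤ 4 * τ * G ^ 2 + n ^ 2 / 16 := by
    nlinarith [sq_nonneg (2 * (√τ * G) - n / 4)]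
  have a := mul_le_mul_of_nonneg_left h2 hn
  have b := mul_le_mul_of_nonneg_left h4 hn
  have c := mul_le_mul_of_nonneg_left h5 hn
  have d := mul_le_mul_of_nonneg_left h6 hn
  have pS := Real.posLog_nonneg (x := S)
  have pτ := Real.posLog_nonneg (x := τ)
  rw [h1, h3]
  nlinarith [mul_nonneg hn pS, mul_nonneg hn pτ, mul_nonneg (sq_nonneg n) pS,
    mul_nonneg (sq_nonneg n) pτ, sq_nonneg n]

/-- The tangent-line form of Jensen's inequality for the entropy, with `ρ = w²`. -/
theorem mul_log_le {ρ I m : ℝ} (hρ : 0 < ρ) (hI : 0 < I) (hm : 2 < m) :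
    ρ * Real.log ρ ≤ (m - 2) / 2 * (ρ ^ (m / (m - 2)) / I - ρ + ρ * Real.log I) := by
  have hm2 : 0 < m - 2 := by linarith
  set P := ρ ^ (m / (m - 2))
  have hP : 0 < P := Real.rpow_pos_of_pos hρ _
  -- With `I = ∫ P` and `∫ ρ = 1`, the quotient `P/(ρI)` has `ρ`-mean one, so integrating `log t ≤ t
  -- - 1` recovers Jensen without loss. Also `P/ρ = ρ^{2/(m-2)}`.
  have h1 : Real.log (P / (ρ * I)) ≤ P / (ρ * I) - 1 := Real.log_le_sub_one_of_pos (by positivity)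
  rw [Real.log_div hP.ne' (by positivity), Real.log_mul hρ.ne' hI.ne', Real.log_rpow hρ] at h1
  have h2 : m / (m - 2) * Real.log ρ = Real.log ρ + 2 / (m - 2) * Real.log ρ := by
    field_simp
    ring
  have h3 : 2 / (m - 2) * Real.log ρ ≤ P / (ρ * I) - 1 + Real.log I := by linarith
  have h4 := mul_le_mul_of_nonneg_left h3 (show 0 ≤ (m - 2) / 2 * ρ by positivity)
  calc ρ * Real.log ρ = (m - 2) / 2 * ρ * (2 / (m - 2) * Real.log ρ) := by field_simp
    _ ≤ _ := h4
    _ = _ := by field_simp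

/-! ### The lower bound for `𝒲` on a closed manifold -/

section ClosedManifold

variable {n : ℕ} {M : Type*} [TopologicalSpace M] [T2Space M] [CompactSpace M]
  [MeasurableSpace M] [ChartedSpace (Model n) M]
  [IsManifold 𝓘(ℝ, Model n) ∞ M]

/-- Admissible functions exist only if the volume is finite. -/
theorem isFiniteMeasure_of_mem_admissible [Nonempty M] {g : Metric n M} {f : M → ℝ} {τ : ℝ}
    (hf : f ∈ admissible g τ) : IsFiniteMeasure (volumeMeasure g) := by
  have hc : Continuous fun x ↦ Real.exp (-f x) := Real.continuous_exp.comp hf.1.continuous.neg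
  have hi : Integrable (fun x ↦ Real.exp (-f x)) (volumeMeasure g) := by
    -- A non-integrable function has integral `0` by convention, contradicting the normalization to
    -- `1`.
    by_contra h
    simpa [integral_undef h] using hf.2
  obtain ⟨x₀, -, hx₀⟩ := isCompact_univ.exists_isMinOn univ_nonempty hc.continuousOn
  have h0 : Real.exp (-f x₀) ≠ 0 := (Real.exp_pos _).ne'
  have : Integrable (fun _ : M ↦ Real.exp (-f x₀)) (volumeMeasure g) :=
    hi.mono' aestronglyMeasurable_const (ae_of_all _ fun x ↦ by
      simpa using isMinOn_iff.1 hx₀ x (mem_univ x))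
  exact (integrable_const_iff_isFiniteMeasure h0).1 this

variable [BorelSpace M]

/-- Ecker's lower bound for `𝒲` on an admissible function. -/
theorem functionalW_ge [Nonempty M] (hn : 3 ≤ n) {g : Metric n M} {C_S τ : ℝ}
    (hS : IsSobolevConstant g C_S) (hτ : 0 < τ) {f : M → ℝ} (hf : f ∈ admissible g τ) :
    -(10 * (n : ℝ) + (n : ℝ) ^ 2) * (1 + Real.posLog C_S + Real.posLog τ)
      + τ * ⨅ x : M, scalarCurvature g x ≤ functionalW g f τ := by
  have := isFiniteMeasure_of_mem_admissible hf
  have hcint {u : M → ℝ} (hu : Continuous u) : Integrable u (volumeMeasure g) :=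
    hu.integrable_of_hasCompactSupport (HasCompactSupport.of_compactSpace u)
  obtain ⟨hfs, hf1⟩ := hf
  set μ := volumeMeasure g
  set k : ℝ := (4 * Real.pi * τ) ^ (-(n : ℝ) / 2) with hk
  have hk0 : 0 < k := Real.rpow_pos_of_pos (by positivity) _
  have hn2 : (2 : ℝ) < n := by exact_mod_cast hn
  have hlogk : Real.log k = -(n / 2 * Real.log (4 * Real.pi * τ)) := by
    rw [hk, Real.log_rpow (by positivity)]
    ring
  -- `a ∘ f` is the function `w`, a smooth function of `f`, hence a valid test function for the
  -- Sobolev inequality.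
  set a : ℝ → ℝ := fun t ↦ √k * Real.exp (-t / 2)
  set ρ : M → ℝ := fun x ↦ k * Real.exp (-f x)
  have hρ0 (x : M) : 0 < ρ x := mul_pos hk0 (Real.exp_pos _)
  have hw0 (x : M) : 0 < (a ∘ f) x := mul_pos (Real.sqrt_pos.2 hk0) (Real.exp_pos _)
  have hw2 (x : M) : (a ∘ f) x ^ 2 = ρ x := by
    simp only [Function.comp_apply, a, ρ, mul_pow, Real.sq_sqrt hk0.le, ← Real.exp_nat_mul]
    congr 2
    push_cast
    ring
  have hws : ContMDiff 𝓘(ℝ, Model n) 𝓘(ℝ, ℝ) ∞ (a ∘ f) := by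
    have ha : ContDiff ℝ ∞ a := by fun_prop
    exact ha.contMDiff.comp hfs
  have hgrad (x : M) : 4 * gradNormSq g (a ∘ f) x = ρ x * gradNormSq g f x := by
    have ha : HasDerivAt a (-(1 / 2) * a (f x)) (f x) := by
      have := (((hasDerivAt_neg (f x)).div_const 2).exp).const_mul (√k)
      refine this.congr_deriv ?_
      simp only [a]
      ring
    rw [gradNormSq_comp g ha ((hfs x).mdifferentiableAt (by simp)), ← hw2]
    simp only [Function.comp_apply]
    ring
  have hpow (x : M) : |(a ∘ f) x| ^ (2 * (n : ℝ) / ((n : ℝ) - 2)) =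
      ρ x ^ ((n : ℝ) / ((n : ℝ) - 2)) := by
    rw [abs_of_pos (hw0 x), ← hw2, ← Real.rpow_natCast, ← Real.rpow_mul (hw0 x).le]
    congr 1
    push_cast
    ring
  have hρc : Continuous ρ := continuous_const.mul (Real.continuous_exp.comp hfs.continuous.neg)
  have hPc : Continuous fun x ↦ ρ x ^ ((n : ℝ) / ((n : ℝ) - 2)) :=
    hρc.rpow_const fun x ↦ Or.inl (hρ0 x).ne'
  have hRc := continuous_scalarCurvature g
  have hGc := continuous_gradNormSq g hws
  have hρ1 : ∫ x, ρ x ∂μ = 1 := by rw [← hf1, integral_const_mul]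
  set I : ℝ := ∫ x, ρ x ^ ((n : ℝ) / ((n : ℝ) - 2)) ∂μ with hI
  have hI0 : 0 < I := by
    rw [hI, integral_pos_iff_support_of_nonneg (fun x ↦ (Real.rpow_pos_of_pos (hρ0 x) _).le)
      (hcint hPc)]
    have hsup : (Function.support fun x ↦ ρ x ^ ((n : ℝ) / ((n : ℝ) - 2))) = univ :=
      eq_univ_of_forall fun x ↦ (Real.rpow_pos_of_pos (hρ0 x) _).ne'
    rw [hsup, Measure.measure_univ_pos]
    intro h0
    simp [h0] at hρ1
  set G : ℝ := √(∫ x, gradNormSq g (a ∘ f) x ∂μ) with hG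
  have hG2 : G ^ 2 = ∫ x, gradNormSq g (a ∘ f) x ∂μ :=
    Real.sq_sqrt (integral_nonneg fun x ↦ gradNormSq_nonneg g _ x)
  have hG0 : 0 ≤ G := Real.sqrt_nonneg _
  -- The Sobolev inequality for `w`, where `‖w‖₂ = 1`.
  have hSob : I ^ (((n : ℝ) - 2) / (2 * n)) ≤ C_S * (1 + G) := by
    have := hS _ hws
    simp only [hpow, hw2] at this
    rwa [hρ1, Real.sqrt_one, add_comm _ 1] at this
  have hIpow : 0 < I ^ (((n : ℝ) - 2) / (2 * n)) := Real.rpow_pos_of_pos hI0 _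
  -- The positive left side of the Sobolev inequality forces this.
  have hCS : 0 < C_S := pos_of_mul_pos_left (hIpow.trans_le hSob) (by positivity)
  have hlogI : ((n : ℝ) - 2) / 2 * Real.log I ≤ n * (Real.log C_S + Real.log (1 + G)) := by
    have h := Real.log_le_log hIpow hSob
    rw [Real.log_rpow hI0, Real.log_mul hCS.ne' (by positivity)] at h
    calc ((n : ℝ) - 2) / 2 * Real.log I = n * (((n : ℝ) - 2) / (2 * n) * Real.log I) := by
          field_simp
      _ ≤ _ := mul_le_mul_of_nonneg_left h (by positivity)
  set r : ℝ := ⨅ x : M, scalarCurvature g x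
  have hr (x : M) : r ≤ scalarCurvature g x := ciInf_le (isCompact_range hRc).bddBelow x
  set c : ℝ := ((n : ℝ) - 2) / 2
  -- Bounding `R` by its infimum and `ρ log ρ` by `mul_log_le` leaves only `ρ`, `|∇w|²` and
  -- `ρ^{n/(n-2)}`, whose integrals are `1`, `G²` and `I`. After integration the two contributions
  -- of `c` alone cancel.
  have hptw (x : M) : (τ * r + Real.log k + c - c * Real.log I - n) * ρ x
      + 4 * τ * gradNormSq g (a ∘ f) x - c / I * ρ x ^ ((n : ℝ) / ((n : ℝ) - 2)) ≤
      k * (Real.exp (-f x) * (τ * (scalarCurvature g x + gradNormSq g f x) + f x - n)) := by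
    have h1 := mul_log_le (hρ0 x) hI0 hn2
    have h2 : Real.log (ρ x) = Real.log k - f x := by
      rw [Real.log_mul hk0.ne' (Real.exp_pos _).ne', Real.log_exp]
      ring
    have h3 := mul_le_mul_of_nonneg_left (hr x) (mul_pos (hρ0 x) hτ).le
    have h4 : k * (Real.exp (-f x) * (τ * (scalarCurvature g x + gradNormSq g f x) + f x - n)) =
        ρ x * τ * scalarCurvature g x + τ * (ρ x * gradNormSq g f x) + ρ x * f x - n * ρ x := by
      simp only [ρ]
      ring
    have h5 : c / I * ρ x ^ ((n : ℝ) / ((n : ℝ) - 2)) =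
        c * (ρ x ^ ((n : ℝ) / ((n : ℝ) - 2)) / I) := by ring
    rw [h4, ← hgrad, h5]
    rw [h2] at h1
    change _ ≤ c * _ at h1
    linarith
  have hGfc := continuous_gradNormSq g hfs
  have hfc := hfs.continuous
  have i1 := (hcint hρc).const_mul (τ * r + Real.log k + c - c * Real.log I - n)
  have i2 := (hcint hGc).const_mul (4 * τ)
  have i3 := (hcint hPc).const_mul (c / I)
  have hint := integral_mono ((i1.add i2).sub i3) (hcint (by fun_prop)) hptw
  have hleft : ∫ x, ((τ * r + Real.log k + c - c * Real.log I - n) * ρ x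
      + 4 * τ * gradNormSq g (a ∘ f) x - c / I * ρ x ^ ((n : ℝ) / ((n : ℝ) - 2))) ∂μ =
      τ * r + Real.log k - c * Real.log I - n + 4 * τ * G ^ 2 := by
    rw [integral_sub (by exact i1.add i2) i3, integral_add i1 i2, integral_const_mul _ ρ, hρ1,
      integral_const_mul, integral_const_mul, ← hG2, ← hI, div_mul_cancel₀ _ hI0.ne']
    ring
  have hW : functionalW g f τ = ∫ x, k * (Real.exp (-f x) *
      (τ * (scalarCurvature g x + gradNormSq g f x) + f x - n)) ∂μ := by
    rw [integral_const_mul, functionalW]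
  have hfin := log_scale_bound (S := C_S) (Nat.cast_nonneg n) hG0 hτ
  rw [hW]
  refine le_trans ?_ (hleft.symm.le.trans hint)
  rw [hlogk]
  linarith

end ClosedManifold

end Perelman

theorem lemma2p2 (n : ℕ) (hn : 3 ≤ n) :
    ∃ C : ℝ, 0 < C ∧
      ∀ (M : Type*) [TopologicalSpace M] [T2Space M] [CompactSpace M] [Nonempty M]
        [MeasurableSpace M] [BorelSpace M]
        [ChartedSpace (Perelman.Model n) M] [IsManifold 𝓘(ℝ, Perelman.Model n) ∞ M]
        (g : Perelman.Metric n M) (C_S τ : ℝ),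
        Perelman.IsSobolevConstant g C_S → 0 < τ →
          ((-C * (1 + Real.posLog C_S + Real.posLog τ)
              + τ * ⨅ x : M, Perelman.scalarCurvature g x : ℝ) : EReal)
            ≤ Perelman.mu g τ := by
  have hn0 : (0 : ℝ) < n := by exact_mod_cast (by omega : 0 < n)
  refine ⟨10 * n + n ^ 2, by positivity, ?_⟩
  intro M _ _ _ _ _ _ _ _ g C_S τ hS hτ
  -- With no admissible function the infimum is `⊤`, so only the bound for each admissible `f` is
  -- needed.
  exact le_iInf₂ fun f hf ↦ EReal.coe_le_coe_iff.2 (Perelman.functionalW_ge hn hS hτ hf)
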